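/- Let $\mathcal A$ be a finite set of linear hyperplanes in $\mathbb R^d$. Its regions are the closures of the connected components of $\mathbb R^d\setminus\bigcup_{H\in\mathcal A}H$. A facet hyperplane of a region $R$ is an $H\in\mathcal A$ for which $R\cap H$ has dimension $d-1$. Assume that $\mathcal A$ is simplicial, that is, for every region the normal vectors of its facet hyperplanes are linearly independent. Fix a region $B$ and let $\mathcal B$ be its set of facet hyperplanes. For a region $R$ let $S(R)$ be the set of those $H\in\mathcal A$ that separate the interior of $R$ from the interior of $B$, and let $\mathcal P(\mathcal A,B)$ be the set of regions, partially ordered by $R\le Q$ if and only if $S(R)\subseteq S(Q)$. For $K\subseteq\mathcal B$ let $\mathcal A_K$ be the set of all $H\in\mathcal A$ that contain $\bigcap_{H'\in K}H'$ (the empty intersection being $\mathbb R^d$), and for a region $R$ of $\mathcal A$ let $R_K$ be the unique region of $\mathcal A_K$ that contains $R$. Let $\Theta_K$ be the equivalence relation on the regions of $\mathcal A$ whose classes are the fibers of $R\mapsto R_K$. Then $\mathcal P(\mathcal A,B)$ is a lattice, and for every $K\subseteq\mathcal B$ the relation $\Theta_K$ is the unique smallest (with respect to refinement) lattice congruence on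 $\mathcal P(\mathcal A,B)$ such that $B\equiv R(H)$ for every $H\in\mathcal B\setminus K$, where $R(H)$ is the region with $S(R(H))=\{H\}$. That is, $\Theta_K$ is a lattice congruence with this property, and it refines every lattice congruence with this property. -/

import Mathlib

noncomputable section

/-- A central hyperplane arrangement in `ℝ^d`: a finite set of linear hyperplanes. -/
structure HyperplaneArrangement (d : ℕ) where
  hyperplanes : Set (Submodule ℝ (EuclideanSpace ℝ (Fin d)))
  finite : hyperplanes.Finite
  codim_one : ∀ H ∈ hyperplanes, Module.finrank ℝ H + 1 = d

namespace HyperplaneArrangement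

variable {d : ℕ}

/-- The complement of the union of the hyperplanes. -/
def complement (A : HyperplaneArrangement d) : Set (EuclideanSpace ℝ (Fin d)) :=
  {x | ∀ H ∈ A.hyperplanes, x ∉ H}

/-- Regions are the closures of the connected components of the complement. -/
def Region (A : HyperplaneArrangement d) : Type :=
  {R : Set (EuclideanSpace ℝ (Fin d)) //
    ∃ x ∈ A.complement, R = closure (connectedComponentIn A.complement x)}

/-- The underlying (closed) set of points of a region. -/
def Region.carrier {A : HyperplaneArrangement d} (R : A.Region) :
    Set (EuclideanSpace ℝ (Fin d)) := R.1

/-- The facet hyperplanes of a region `R`: those `H` in the arrangement such that `R ∩ H` is of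
full dimension in `H` (it is a cone, so its dimension is that of its linear span). -/
def facetHyperplanes (A : HyperplaneArrangement d) (R : A.Region) :
    Set (Submodule ℝ (EuclideanSpace ℝ (Fin d))) :=
  {H | H ∈ A.hyperplanes ∧
    Submodule.span ℝ (R.carrier ∩ (H : Set (EuclideanSpace ℝ (Fin d)))) = H}

/-- A region is simplicial if the normal vectors to its facets are linearly independent
(for any choice of nonzero normal vectors, one for each facet hyperplane). -/
def IsSimplicialRegion (A : HyperplaneArrangement d) (R : A.Region) : Prop :=
  ∀ n : A.facetHyperplanes R → EuclideanSpace ℝ (Fin d),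
    (∀ H, n H ≠ 0 ∧ n H ∈ (H : Submodule ℝ (EuclideanSpace ℝ (Fin d)))ᗮ) →
      LinearIndependent ℝ n

/-- An arrangement is simplicial if each of its regions is. -/
def IsSimplicial (A : HyperplaneArrangement d) : Prop :=
  ∀ R : A.Region, A.IsSimplicialRegion R

/-- The separating set `S(R)` with respect to the base region `B`: the hyperplanes `H` which are
the kernel of a linear functional that is negative in the interior of `B` and positive in the
interior of `R`. -/
def separatingSet (A : HyperplaneArrangement d) (B R : A.Region) :
    Set (Submodule ℝ (EuclideanSpace ℝ (Fin d))) :=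
  {H | H ∈ A.hyperplanes ∧ ∃ f : EuclideanSpace ℝ (Fin d) →ₗ[ℝ] ℝ, LinearMap.ker f = H ∧
    (∀ x ∈ interior B.carrier, f x < 0) ∧ ∀ x ∈ interior R.carrier, 0 < f x}

theorem isOpen_complement (A : HyperplaneArrangement d) : IsOpen A.complement := by
  have h : A.complement =
      ⋂ H ∈ A.hyperplanes, ((H : Set (EuclideanSpace ℝ (Fin d))))ᶜ := by
    ext x; simp [complement]
  rw [h]
  exact A.finite.isOpen_biInter fun H _ => (Submodule.closed_of_finiteDimensional H).isOpen_compl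

theorem exists_functional (A : HyperplaneArrangement d)
    {H : Submodule ℝ (EuclideanSpace ℝ (Fin d))} (hH : H ∈ A.hyperplanes) :
    ∃ f : EuclideanSpace ℝ (Fin d) →ₗ[ℝ] ℝ, LinearMap.ker f = H := by
  have h1 := A.codim_one H hH
  have hlt : H < ⊤ := by
    rw [lt_top_iff_ne_top]
    rintro rfl
    rw [finrank_top, finrank_euclideanSpace_fin] at h1
    omega
  obtain ⟨f, hf, hle⟩ := Submodule.exists_le_ker_of_lt_top H hlt
  refine ⟨f, (Submodule.eq_of_le_of_finrank_le hle ?_).symm⟩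
  have h2 : Module.finrank ℝ (LinearMap.ker f) < d := by
    have := Submodule.finrank_lt (s := LinearMap.ker f)
      (fun h => hf (LinearMap.ker_eq_top.1 h))
    rwa [finrank_euclideanSpace_fin] at this
  omega

/-- A functional vanishing only on a hyperplane of the arrangement has constant sign in the
interior of a region. -/
theorem pos_of_mem_interior (A : HyperplaneArrangement d) {x : EuclideanSpace ℝ (Fin d)}
    (hx : x ∈ A.complement) {f : EuclideanSpace ℝ (Fin d) →ₗ[ℝ] ℝ}
    (hf : LinearMap.ker f ∈ A.hyperplanes) (hfx : 0 < f x) :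
    ∀ y ∈ interior (closure (connectedComponentIn A.complement x)), 0 < f y := by
  have hc : Continuous f := f.continuous_of_finiteDimensional
  have h0 : ∀ y ∈ connectedComponentIn A.complement x, 0 ≤ f y := by
    intro y hy
    by_contra hlt
    obtain ⟨z, hz, hz0⟩ := isPreconnected_connectedComponentIn.intermediate_value hy
      (mem_connectedComponentIn hx) hc.continuousOn ⟨(not_le.1 hlt).le, hfx.le⟩
    exact connectedComponentIn_subset _ _ hz _ hf hz0
  have h1 : ∀ y ∈ closure (connectedComponentIn A.complement x), 0 ≤ f y := fun y hy =>
    closure_minimal (t := {z | 0 ≤ f z}) h0 (isClosed_le continuous_const hc) hy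
  intro y hy
  have ht : Filter.Tendsto (fun t : ℝ => y - t • x) (nhds 0) (nhds y) := by
    have : Continuous fun t : ℝ => y - t • x := by fun_prop
    simpa using this.tendsto 0
  have hev := (ht.eventually (isOpen_interior.mem_nhds hy)).filter_mono
    (nhdsWithin_le_nhds (s := Set.Ioi 0))
  obtain ⟨t, hty, ht0⟩ := (hev.and self_mem_nhdsWithin).exists
  have := h1 _ (interior_subset hty)
  have ht0' : (0 : ℝ) < t := ht0
  simp only [map_sub, map_smul, smul_eq_mul] at this
  nlinarith [mul_pos ht0' hfx]

theorem component_subset_interior (A : HyperplaneArrangement d)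
    (x : EuclideanSpace ℝ (Fin d)) :
    connectedComponentIn A.complement x ⊆
      interior (closure (connectedComponentIn A.complement x)) :=
  A.isOpen_complement.connectedComponentIn.subset_interior_closure

/-- A region is determined by its separating set. -/
theorem separatingSet_injective (A : HyperplaneArrangement d) (B : A.Region) :
    Function.Injective (A.separatingSet B) := by
  have key : ∀ (R : A.Region) (b x : EuclideanSpace ℝ (Fin d)),
      b ∈ A.complement → B.carrier = closure (connectedComponentIn A.complement b) →
      x ∈ A.complement → R.carrier = closure (connectedComponentIn A.complement x) →
      ∀ f : EuclideanSpace ℝ (Fin d) →ₗ[ℝ] ℝ, LinearMap.ker f ∈ A.hyperplanes → f b < 0 →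
        (LinearMap.ker f ∈ A.separatingSet B R ↔ 0 < f x) := by
    intro R b x hb hB hx hR f hf hfb
    constructor
    · rintro ⟨-, g, hg, hgB, hgR⟩
      have hgb : g b < 0 := hgB b (by
        rw [hB]; exact A.component_subset_interior b (mem_connectedComponentIn hb))
      have hgx : 0 < g x := hgR x (by
        rw [hR]; exact A.component_subset_interior x (mem_connectedComponentIn hx))
      -- the vector `g b • x - g x • b` lies in the common kernel of `g` and `f`
      have hz : g b • x - g x • b ∈ LinearMap.ker f := by
        rw [← hg]; simp [mul_comm]
      simp only [LinearMap.mem_ker, map_sub, map_smul, smul_eq_mul] at hz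
      by_contra hle
      nlinarith [mul_pos_of_neg_of_neg hfb (neg_lt_zero.2 hgx),
        mul_nonneg_of_nonpos_of_nonpos hgb.le (not_lt.1 hle)]
    · intro hfx
      refine ⟨hf, f, rfl, ?_, ?_⟩
      · intro y hy
        rw [hB] at hy
        have hker : LinearMap.ker (-f) = LinearMap.ker f := by ext; simp
        have := A.pos_of_mem_interior hb (f := -f) (by rwa [hker]) (by simpa using hfb) y hy
        simpa using this
      · rw [hR]
        exact A.pos_of_mem_interior hx hf hfx
  intro R Q hRQ
  obtain ⟨b, hb, hB⟩ := B.2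
  obtain ⟨x, hx, hR⟩ := R.2
  obtain ⟨y, hy, hQ⟩ := Q.2
  have hseg : segment ℝ x y ⊆ A.complement := by
    rintro _ ⟨s, t, hs, ht, hst, rfl⟩ H hH hmem
    obtain ⟨f, hfb, rfl⟩ : ∃ f : EuclideanSpace ℝ (Fin d) →ₗ[ℝ] ℝ,
        f b < 0 ∧ LinearMap.ker f = H := by
      obtain ⟨f, rfl⟩ := A.exists_functional hH
      rcases lt_trichotomy (f b) 0 with h | h | h
      · exact ⟨f, h, rfl⟩
      · exact absurd h (hb _ hH)
      · exact ⟨-f, by simpa using h, by ext; simp⟩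
    have h1 := key R b x hb hB hx hR f hH hfb
    have h2 := key Q b y hb hB hy hQ f hH hfb
    rw [hRQ] at h1
    have h3 := h1.symm.trans h2
    have hx0 : f x ≠ 0 := hx _ hH
    have hy0 : f y ≠ 0 := hy _ hH
    simp only [LinearMap.mem_ker, map_add, map_smul, smul_eq_mul] at hmem
    rcases lt_or_gt_of_ne hx0 with h | h
    · have hy' : f y < 0 := lt_of_le_of_ne (not_lt.1 fun h' => absurd (h3.2 h') h.not_gt) hy0
      rcases hs.eq_or_lt with rfl | hs
      · nlinarith
      · nlinarith [mul_pos hs (neg_pos.2 h), mul_nonneg ht (neg_pos.2 hy').le]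
    · have hy' := h3.1 h
      rcases hs.eq_or_lt with rfl | hs
      · nlinarith
      · nlinarith [mul_pos hs h, mul_nonneg ht hy'.le]
  have hmem : y ∈ connectedComponentIn A.complement x :=
    (convex_segment x y).isPreconnected.subset_connectedComponentIn
      (left_mem_segment ℝ x y) hseg (right_mem_segment ℝ x y)
  apply Subtype.ext
  rw [hR, hQ, connectedComponentIn_eq hmem]

/-- The poset of regions `P(A, B)`: regions ordered by inclusion of separating sets. -/
@[reducible]
def posetOfRegions (A : HyperplaneArrangement d) (B : A.Region) : PartialOrder A.Region where
  le R Q := A.separatingSet B R ⊆ A.separatingSet B Q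
  le_refl _ := subset_rfl
  le_trans _ _ _ h₁ h₂ := h₁.trans h₂
  le_antisymm _ _ h₁ h₂ := A.separatingSet_injective B (h₁.antisymm h₂)

/-- The subarrangement `A_K` of all hyperplanes of `A` that contain the intersection `L_K` of
the members of `K` (the empty intersection is the whole space). -/
def parabolicSubarrangement (A : HyperplaneArrangement d)
    (K : Set (Submodule ℝ (EuclideanSpace ℝ (Fin d)))) : HyperplaneArrangement d where
  hyperplanes := {H | H ∈ A.hyperplanes ∧ sInf K ≤ H}
  finite := A.finite.subset fun _ h => h.1
  codim_one H h := A.codim_one H h.1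

/-- Each region of `A` lies in exactly one region of `A_K`. -/
theorem existsUnique_parabolicRegion (A : HyperplaneArrangement d)
    (K : Set (Submodule ℝ (EuclideanSpace ℝ (Fin d)))) (R : A.Region) :
    ∃! Q : (A.parabolicSubarrangement K).Region, R.carrier ⊆ Q.carrier := by
  obtain ⟨x, hx, hR⟩ := R.2
  have hsub : A.complement ⊆ (A.parabolicSubarrangement K).complement := fun _ h H hH => h H hH.1
  refine ⟨⟨_, x, hsub hx, rfl⟩, ?_, ?_⟩
  · change R.1 ⊆ closure _
    rw [hR]
    exact closure_mono (connectedComponentIn_mono x hsub)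
  · rintro ⟨_, y, hy, rfl⟩ hsubQ
    have hxy : x ∈ closure (connectedComponentIn (A.parabolicSubarrangement K).complement y) := by
      apply hsubQ
      change x ∈ R.1
      rw [hR]
      exact subset_closure (mem_connectedComponentIn hx)
    obtain ⟨z, hzx, hzy⟩ := mem_closure_iff.1 hxy _
      ((A.parabolicSubarrangement K).isOpen_complement.connectedComponentIn)
      (mem_connectedComponentIn (hsub hx))
    apply Subtype.ext
    change closure _ = closure _
    rw [connectedComponentIn_eq hzx, connectedComponentIn_eq hzy]

/-- The map `R ↦ R_K`, where `R_K` is the region of `A_K` that contains `R`. -/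
def parabolicRegion (A : HyperplaneArrangement d)
    (K : Set (Submodule ℝ (EuclideanSpace ℝ (Fin d)))) (R : A.Region) :
    (A.parabolicSubarrangement K).Region :=
  (A.existsUnique_parabolicRegion K R).choose

/-- The equivalence relation `Θ_K` whose classes are the fibers of `R ↦ R_K`. -/
def parabolicCongruence (A : HyperplaneArrangement d)
    (K : Set (Submodule ℝ (EuclideanSpace ℝ (Fin d)))) : Setoid A.Region :=
  Setoid.ker (A.parabolicRegion K)

end HyperplaneArrangement

end

noncomputable section

namespace HyperplaneArrangement

variable {d : ℕ}

/-! With functionals positive at a point of `B`, a region is a sign vector and its separating set is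
the set of negative signs. The geometry rests on two facts. The facet inequalities of a region imply
all its inequalities (`nonneg_of_nonneg_facets`). In a simplicial region any set `K` of facets cuts
out a face with a point lying on exactly the hyperplanes of `A_K` (`exists_face_point`); perturbing
that point produces regions with the required signs.

Joins are local: if `X` and `Y` lie beyond facets `H₁`, `H₂` of a common lower bound `Z`, every
upper bound of both contains the region obtained from `Z` by reversing all of `A_{H₁,H₂}`, and
induction upwards from `Z` finishes. Meets follow through the antipodal map.

A class of `Θ_K` is a fixed trace `S(R) ∩ A_K`. It has least element `S(R) ∩ A_K` and greatest
element `S(R) ∪ (A \ A_K)`; both depend monotonically on `R`, so `Θ_K` is a congruence. Conversely,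
let `S(D) = A_K`. A congruence collapsing the `R(H)` with `H ∉ K` identifies `D` with the top, hence
`R ⊓ D` with `R`, and `R ⊓ D` depends only on the trace of `R`. -/

/-- `φ` assigns to each hyperplane of `A` a defining functional that is positive at `x`. -/
def PositiveAt (A : HyperplaneArrangement d)
    (φ : Submodule ℝ (EuclideanSpace ℝ (Fin d)) → EuclideanSpace ℝ (Fin d) →ₗ[ℝ] ℝ)
    (x : EuclideanSpace ℝ (Fin d)) : Prop :=
  ∀ H ∈ A.hyperplanes, LinearMap.ker (φ H) = H ∧ 0 < φ H x

/-- The region of `A` containing the point `x` of the complement. -/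
def regionOf (A : HyperplaneArrangement d) (x : EuclideanSpace ℝ (Fin d))
    (hx : x ∈ A.complement) : A.Region :=
  ⟨closure (connectedComponentIn A.complement x), x, hx, rfl⟩

theorem exists_eq_regionOf (A : HyperplaneArrangement d) (R : A.Region) :
    ∃ x, ∃ hx : x ∈ A.complement, R = A.regionOf x hx := by
  obtain ⟨x, hx, hR⟩ := R.2
  exact ⟨x, hx, Subtype.ext hR⟩

theorem exists_positiveAt (A : HyperplaneArrangement d) {x : EuclideanSpace ℝ (Fin d)}
    (hx : x ∈ A.complement) : ∃ φ, A.PositiveAt φ x := by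
  have h : ∀ H, ∃ f : EuclideanSpace ℝ (Fin d) →ₗ[ℝ] ℝ,
      H ∈ A.hyperplanes → LinearMap.ker f = H ∧ 0 < f x := by
    intro H
    by_cases hH : H ∈ A.hyperplanes
    · obtain ⟨f, rfl⟩ := A.exists_functional hH
      rcases lt_trichotomy (f x) 0 with h | h | h
      · exact ⟨-f, fun _ => ⟨by ext; simp, by simpa using h⟩⟩
      · exact absurd h (hx _ hH)
      · exact ⟨f, fun _ => ⟨rfl, h⟩⟩
    · exact ⟨0, fun h => absurd h hH⟩
  choose φ hφ using h
  exact ⟨φ, fun H hH => hφ H hH⟩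

/-! ### Regions as sign vectors -/

variable {A : HyperplaneArrangement d}
  {φ : Submodule ℝ (EuclideanSpace ℝ (Fin d)) → EuclideanSpace ℝ (Fin d) →ₗ[ℝ] ℝ}

theorem PositiveAt.mem_iff {b x : EuclideanSpace ℝ (Fin d)} (hφ : A.PositiveAt φ b)
    {H : Submodule ℝ (EuclideanSpace ℝ (Fin d))} (hH : H ∈ A.hyperplanes) :
    x ∈ H ↔ φ H x = 0 := by
  rw [← LinearMap.mem_ker, (hφ H hH).1]

theorem PositiveAt.ne_zero {b x : EuclideanSpace ℝ (Fin d)} (hφ : A.PositiveAt φ b)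
    (hx : x ∈ A.complement) {H : Submodule ℝ (EuclideanSpace ℝ (Fin d))}
    (hH : H ∈ A.hyperplanes) : φ H x ≠ 0 :=
  fun h => hx H hH ((hφ.mem_iff hH).2 h)

theorem PositiveAt.mem_complement {b x : EuclideanSpace ℝ (Fin d)} (hφ : A.PositiveAt φ b)
    (hx : ∀ H ∈ A.hyperplanes, φ H x ≠ 0) : x ∈ A.complement :=
  fun H hH h => hx H hH ((hφ.mem_iff hH).1 h)

theorem PositiveAt.self_mem_complement {b : EuclideanSpace ℝ (Fin d)} (hφ : A.PositiveAt φ b) :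
    b ∈ A.complement :=
  hφ.mem_complement fun H hH => (hφ H hH).2.ne'

theorem PositiveAt.pos_of_not_neg {b x : EuclideanSpace ℝ (Fin d)} (hφ : A.PositiveAt φ b)
    (hx : x ∈ A.complement) {H : Submodule ℝ (EuclideanSpace ℝ (Fin d))}
    (hH : H ∈ A.hyperplanes) (h : ¬ φ H x < 0) : 0 < φ H x :=
  lt_of_le_of_ne (not_lt.1 h) (hφ.ne_zero hx hH).symm

theorem PositiveAt.restrict {b : EuclideanSpace ℝ (Fin d)} (hφ : A.PositiveAt φ b)
    (K : Set (Submodule ℝ (EuclideanSpace ℝ (Fin d)))) :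
    (A.parabolicSubarrangement K).PositiveAt φ b :=
  fun H hH => hφ H hH.1

theorem complement_subset_parabolic (A : HyperplaneArrangement d)
    (K : Set (Submodule ℝ (EuclideanSpace ℝ (Fin d)))) :
    A.complement ⊆ (A.parabolicSubarrangement K).complement :=
  fun _ h H hH => h H hH.1

theorem PositiveAt.mem_separatingSet {b x : EuclideanSpace ℝ (Fin d)} (hφ : A.PositiveAt φ b)
    (hb : b ∈ A.complement) (hx : x ∈ A.complement)
    {H : Submodule ℝ (EuclideanSpace ℝ (Fin d))} :
    H ∈ A.separatingSet (A.regionOf b hb) (A.regionOf x hx) ↔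
      H ∈ A.hyperplanes ∧ φ H x < 0 := by
  constructor
  · rintro ⟨hH, g, hg, hgB, hgR⟩
    refine ⟨hH, ?_⟩
    have hgb : g b < 0 := hgB b (A.component_subset_interior b (mem_connectedComponentIn hb))
    have hgx : 0 < g x := hgR x (A.component_subset_interior x (mem_connectedComponentIn hx))
    -- This vector is killed by `g`, hence by `φ H`; so `φ H` changes sign between `b` and `x` as
    -- `g` does.
    have hz : g b • x - g x • b ∈ H := by
      rw [← hg]; simp [mul_comm]
    rw [hφ.mem_iff hH] at hz
    simp only [map_sub, map_smul, smul_eq_mul] at hz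
    have h2 := mul_pos hgx (hφ H hH).2
    by_contra hle
    nlinarith [mul_nonneg (neg_pos.2 hgb).le (not_lt.1 hle)]
  · rintro ⟨hH, hfx⟩
    have hk := (hφ H hH).1
    have hkn : LinearMap.ker (-φ H) = H := by rw [← hk]; ext; simp [hk]
    refine ⟨hH, -φ H, hkn, ?_, ?_⟩
    · intro y hy
      have := A.pos_of_mem_interior hb (f := φ H) (by rwa [hk]) (hφ H hH).2 y hy
      simpa using this
    · exact A.pos_of_mem_interior hx (f := -φ H) (by rwa [hkn]) (by simpa using hfx)

theorem PositiveAt.regionOf_eq_iff {b x y : EuclideanSpace ℝ (Fin d)} (hφ : A.PositiveAt φ b)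
    (hx : x ∈ A.complement) (hy : y ∈ A.complement) :
    A.regionOf x hx = A.regionOf y hy ↔
      ∀ H ∈ A.hyperplanes, (φ H x < 0 ↔ φ H y < 0) := by
  rw [← (A.separatingSet_injective (A.regionOf b hφ.self_mem_complement)).eq_iff, Set.ext_iff]
  refine forall_congr' fun H => ?_
  rw [hφ.mem_separatingSet, hφ.mem_separatingSet]
  tauto

/-- The closed cone cut out by the functionals lies in the region on which they are positive. -/
theorem PositiveAt.mem_carrier {z y : EuclideanSpace ℝ (Fin d)} (hφ : A.PositiveAt φ z)
    (hz : z ∈ A.complement) (hy : ∀ H ∈ A.hyperplanes, 0 ≤ φ H y) :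
    y ∈ (A.regionOf z hz).carrier := by
  have hconv : Convex ℝ {v | ∀ H ∈ A.hyperplanes, 0 < φ H v} := by
    have : {v | ∀ H ∈ A.hyperplanes, 0 < φ H v} =
        ⋂ H ∈ A.hyperplanes, {v | 0 < φ H v} := by ext; simp
    rw [this]
    exact convex_iInter₂ fun H _ => convex_halfSpace_gt (φ H).isLinear 0
  have hsub : {v | ∀ H ∈ A.hyperplanes, 0 < φ H v} ⊆ connectedComponentIn A.complement z :=
    hconv.isPreconnected.subset_connectedComponentIn (fun H hH => (hφ H hH).2)
      fun v hv => hφ.mem_complement fun H hH => (hv H hH).ne'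
  have ht : Filter.Tendsto (fun t : ℝ => y + t • z) (nhdsWithin 0 (Set.Ioi 0)) (nhds y) := by
    have : Continuous fun t : ℝ => y + t • z := by fun_prop
    simpa using (this.tendsto 0).mono_left nhdsWithin_le_nhds
  refine mem_closure_of_tendsto ht ?_
  filter_upwards [self_mem_nhdsWithin] with t ht
  refine hsub fun H hH => ?_
  have ht' : (0 : ℝ) < t := ht
  have := hy H hH
  have := mul_pos ht' (hφ H hH).2
  simp only [map_add, map_smul, smul_eq_mul]
  linarith

/-- Moving from `p` slightly towards `x` breaks the ties at `p` by the signs at `x`. -/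
theorem PositiveAt.exists_perturbation {b : EuclideanSpace ℝ (Fin d)} (hφ : A.PositiveAt φ b)
    (p : EuclideanSpace ℝ (Fin d)) {x : EuclideanSpace ℝ (Fin d)} (hx : x ∈ A.complement) :
    ∃ y ∈ A.complement, ∀ H ∈ A.hyperplanes,
      (φ H p ≠ 0 → (φ H y < 0 ↔ φ H p < 0)) ∧ (φ H p = 0 → (φ H y < 0 ↔ φ H x < 0)) := by
  have key : ∀ H ∈ A.hyperplanes, ∀ᶠ t : ℝ in nhdsWithin 0 (Set.Ioi 0),
      φ H (p + t • x) ≠ 0 ∧ (φ H p ≠ 0 → (φ H (p + t • x) < 0 ↔ φ H p < 0)) ∧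
        (φ H p = 0 → (φ H (p + t • x) < 0 ↔ φ H x < 0)) := by
    intro H hH
    have ht : Filter.Tendsto (fun t : ℝ => φ H (p + t • x)) (nhdsWithin 0 (Set.Ioi 0))
        (nhds (φ H p)) := by
      have : Continuous fun t : ℝ => φ H (p + t • x) :=
        (φ H).continuous_of_finiteDimensional.comp (by fun_prop)
      simpa using (this.tendsto 0).mono_left nhdsWithin_le_nhds
    rcases lt_trichotomy (φ H p) 0 with h | h | h
    · filter_upwards [ht.eventually_lt_const h] with t ht
      exact ⟨ht.ne, fun _ => iff_of_true ht h, fun h' => absurd h' h.ne⟩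
    · filter_upwards [self_mem_nhdsWithin] with t ht
      have ht' : (0 : ℝ) < t := ht
      have hx0 := hφ.ne_zero hx hH
      simp only [map_add, map_smul, smul_eq_mul, h, zero_add]
      exact ⟨mul_ne_zero ht'.ne' hx0, fun h' => absurd rfl h',
        fun _ => by rw [mul_neg_iff]; simp [ht', ht'.not_gt]⟩
    · filter_upwards [ht.eventually_const_lt h] with t ht
      exact ⟨ht.ne', fun _ => iff_of_false ht.not_gt h.not_gt, fun h' => absurd h' h.ne'⟩
  obtain ⟨t, ht⟩ := ((Filter.eventually_all_finite A.finite).2 key).exists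
  exact ⟨p + t • x, hφ.mem_complement fun H hH => (ht H hH).1, fun H hH => (ht H hH).2⟩

/-! ### Facets and faces -/

/-- The facet inequalities of a region imply all the inequalities of the region. -/
theorem PositiveAt.nonneg_of_nonneg_facets {z y : EuclideanSpace ℝ (Fin d)}
    (hφ : A.PositiveAt φ z) (hz : z ∈ A.complement)
    (hy : ∀ H ∈ A.facetHyperplanes (A.regionOf z hz), 0 ≤ φ H y) :
    ∀ H ∈ A.hyperplanes, 0 ≤ φ H y := by
  -- `P S`: the inequalities of `S` imply all the others. Members of a minimal such `S` turn out to
  -- be facets.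
  let P : Set (Submodule ℝ (EuclideanSpace ℝ (Fin d))) → Prop := fun S =>
    S ⊆ A.hyperplanes ∧ ∀ v, (∀ H ∈ S, 0 ≤ φ H v) → ∀ H ∈ A.hyperplanes, 0 ≤ φ H v
  have hfin : {S | P S}.Finite := A.finite.finite_subsets.subset fun S hS => hS.1
  obtain ⟨S, hS⟩ := hfin.exists_minimal ⟨A.hyperplanes, subset_rfl, fun v h => h⟩
  obtain ⟨hSA, hSgen⟩ := hS.prop
  refine hSgen y fun H₀ hH₀ => hy H₀ ?_
  refine ⟨hSA hH₀, ?_⟩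
  have hH₀A := hSA hH₀
  obtain ⟨v, hv, hv₀⟩ : ∃ v, (∀ H ∈ S \ {H₀}, 0 ≤ φ H v) ∧ φ H₀ v < 0 := by
    by_contra! hcon
    have hP : P (S \ {H₀}) := by
      refine ⟨Set.sdiff_subset.trans hSA, fun v hv => hSgen v fun H hH => ?_⟩
      by_cases h : H = H₀
      · exact h ▸ hcon v hv
      · exact hv H ⟨hH, h⟩
    exact (hS.le_of_le hP Set.sdiff_subset hH₀).2 rfl
  have hz₀ := (hφ H₀ hH₀A).2
  -- the point where the segment from `z` to `v` crosses `H₀`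
  set q := φ H₀ z • v - φ H₀ v • z with hq
  have hq₀ : φ H₀ q = 0 := by simp [hq, mul_comm]
  have hqS : ∀ H ∈ S \ {H₀}, 0 < φ H q := by
    intro H hH
    have h1 := mul_nonneg hz₀.le (hv H hH)
    have h2 := mul_pos (neg_pos.2 hv₀) (hφ H (hSA hH.1)).2
    simp only [hq, map_sub, map_smul, smul_eq_mul]
    linarith
  apply le_antisymm
  · exact Submodule.span_le.2 fun v hv => hv.2
  · intro u hu
    have hu₀ : φ H₀ u = 0 := (hφ.mem_iff hH₀A).1 hu
    -- The other inequalities of `S` are strict at `q`, so a small move along `H₀` stays in the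
    -- region; hence `u` is in the span.
    have hev : ∀ᶠ t : ℝ in nhdsWithin 0 (Set.Ioi 0), ∀ H ∈ S, 0 ≤ φ H (q + t • u) := by
      rw [Filter.eventually_all_finite (A.finite.subset hSA)]
      intro H hH
      by_cases h : H = H₀
      · subst h
        simp [hq₀, hu₀]
      · have ht : Filter.Tendsto (fun t : ℝ => φ H (q + t • u)) (nhdsWithin 0 (Set.Ioi 0))
            (nhds (φ H q)) := by
          have : Continuous fun t : ℝ => φ H (q + t • u) :=
            (φ H).continuous_of_finiteDimensional.comp (by fun_prop)
          simpa using (this.tendsto 0).mono_left nhdsWithin_le_nhds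
        filter_upwards [ht.eventually_const_lt (hqS H ⟨hH, h⟩)] with t ht using ht.le
    obtain ⟨t, ht, ht0⟩ := (hev.and self_mem_nhdsWithin).exists
    have ht0 : (0 : ℝ) < t := ht0
    have hq_mem : q ∈ (A.regionOf z hz).carrier ∩ (H₀ : Set (EuclideanSpace ℝ (Fin d))) := by
      refine ⟨hφ.mem_carrier hz (hSgen q fun H hH => ?_), (hφ.mem_iff hH₀A).2 hq₀⟩
      by_cases h : H = H₀
      · rw [h, hq₀]
      · exact (hqS H ⟨hH, h⟩).le
    have hqt_mem : q + t • u ∈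
        (A.regionOf z hz).carrier ∩ (H₀ : Set (EuclideanSpace ℝ (Fin d))) :=
      ⟨hφ.mem_carrier hz (hSgen _ ht), (hφ.mem_iff hH₀A).2 (by simp [hq₀, hu₀])⟩
    have hu_eq : u = t⁻¹ • ((q + t • u) - q) := by
      rw [add_sub_cancel_left, smul_smul, inv_mul_cancel₀ ht0.ne', one_smul]
    rw [hu_eq]
    exact Submodule.smul_mem _ _
      (Submodule.sub_mem _ (Submodule.subset_span hqt_mem) (Submodule.subset_span hq_mem))

/-- The defining functionals of the facets of a simplicial region take arbitrary prescribed
values. -/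
theorem PositiveAt.exists_facet_values {z : EuclideanSpace ℝ (Fin d)}
    (hφ : A.PositiveAt φ z) (hz : z ∈ A.complement)
    (hsimp : A.IsSimplicialRegion (A.regionOf z hz))
    (c : Submodule ℝ (EuclideanSpace ℝ (Fin d)) → ℝ) :
    ∃ p, ∀ H ∈ A.facetHyperplanes (A.regionOf z hz), φ H p = c H := by
  -- Riesz vectors turn the functionals into normals, to which simpliciality applies.
  let n : A.facetHyperplanes (A.regionOf z hz) → EuclideanSpace ℝ (Fin d) := fun H =>
    (InnerProductSpace.toDual ℝ (EuclideanSpace ℝ (Fin d))).symm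
      (LinearMap.toContinuousLinearMap (φ H))
  have hn : ∀ H v, inner ℝ (n H) v = φ H v := fun H v => by
    simp [n, InnerProductSpace.toDual_symm_apply]
  have hli : LinearIndependent ℝ n := by
    refine hsimp n fun H => ⟨fun h0 => ?_, ?_⟩
    · have h1 := hn H z
      rw [h0, inner_zero_left] at h1
      exact (hφ H H.2.1).2.ne h1
    · rw [Submodule.mem_orthogonal']
      intro v hv
      rw [hn]
      exact (hφ.mem_iff H.2.1).1 hv
  obtain ⟨g, hg⟩ := ((Module.Basis.span hli).constr ℝ fun H => c H).exists_extend
  refine ⟨(InnerProductSpace.toDual ℝ (EuclideanSpace ℝ (Fin d))).symm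
      (LinearMap.toContinuousLinearMap g), fun H hH => ?_⟩
  rw [← hn ⟨H, hH⟩, real_inner_comm, InnerProductSpace.toDual_symm_apply]
  have h1 := LinearMap.congr_fun hg (Module.Basis.span hli ⟨H, hH⟩)
  rw [Module.Basis.constr_basis, LinearMap.comp_apply] at h1
  simpa [Module.Basis.span_apply] using h1

/-- A set `K` of facets of a simplicial region spans a face: there is a point `p` of the region
lying on exactly those hyperplanes that contain the intersection of `K`, and the inequalities of
these hyperplanes follow from those of `K`. -/
theorem PositiveAt.exists_face_point {z : EuclideanSpace ℝ (Fin d)}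
    (hφ : A.PositiveAt φ z) (hz : z ∈ A.complement)
    (hsimp : A.IsSimplicialRegion (A.regionOf z hz))
    {K : Set (Submodule ℝ (EuclideanSpace ℝ (Fin d)))}
    (hK : K ⊆ A.facetHyperplanes (A.regionOf z hz)) :
    ∃ p, (∀ H ∈ A.hyperplanes, 0 ≤ φ H p) ∧
      (∀ H ∈ A.hyperplanes, (φ H p = 0 ↔ sInf K ≤ H)) ∧
      (∀ H ∈ A.facetHyperplanes (A.regionOf z hz), sInf K ≤ H → H ∈ K) ∧
      ∀ v, (∀ H ∈ K, 0 ≤ φ H v) → ∀ H ∈ A.hyperplanes, sInf K ≤ H → 0 ≤ φ H v := by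
  classical
  -- `p` lies on the facets in `K` and strictly inside the other facet inequalities.
  obtain ⟨p, hp⟩ := hφ.exists_facet_values hz hsimp fun H => if H ∈ K then 0 else 1
  have hpK : ∀ H ∈ K, φ H p = 0 := fun H hH => by rw [hp H (hK hH), if_pos hH]
  have hpn : ∀ H ∈ A.facetHyperplanes (A.regionOf z hz), H ∉ K → φ H p = 1 :=
    fun H hH hn => by rw [hp H hH, if_neg hn]
  have hp_inf : p ∈ sInf K :=
    (Submodule.mem_sInf).2 fun H hH => (hφ.mem_iff (hK hH).1).2 (hpK H hH)
  have hzero : ∀ H ∈ A.hyperplanes, sInf K ≤ H → φ H p = 0 :=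
    fun H hH hle => (hφ.mem_iff hH).1 (hle hp_inf)
  -- Adding a large multiple of `p` to `v` repairs the facet inequalities outside `K` and changes no
  -- value on a hyperplane through `p`.
  have hgen : ∀ v, (∀ H ∈ K, 0 ≤ φ H v) → ∀ H ∈ A.hyperplanes, φ H p = 0 → 0 ≤ φ H v := by
    intro v hv H hH hH0
    have hfin : (A.facetHyperplanes (A.regionOf z hz)).Finite := A.finite.subset fun _ h => h.1
    obtain ⟨t, ht⟩ : ∃ t : ℝ, ∀ F ∈ A.facetHyperplanes (A.regionOf z hz), -φ F v ≤ t := by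
      obtain ⟨t, ht⟩ := (hfin.image fun F => -φ F v).bddAbove
      exact ⟨t, fun F hF => ht ⟨F, hF, rfl⟩⟩
    have := hφ.nonneg_of_nonneg_facets hz (y := v + t • p) (fun F hF => by
      by_cases hFK : F ∈ K
      · simpa [hpK F hFK] using hv F hFK
      · have := ht F hF
        simp only [map_add, map_smul, smul_eq_mul, hpn F hF hFK]
        linarith) H hH
    simpa [hH0] using this
  refine ⟨p, ?_, fun H hH => ⟨fun h0 v hv => ?_, hzero H hH⟩, fun H hH hle => ?_,
    fun v hv H hH hle => hgen v hv H hH (hzero H hH hle)⟩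
  · refine hφ.nonneg_of_nonneg_facets hz fun F hF => ?_
    by_cases hFK : F ∈ K
    · rw [hpK F hFK]
    · rw [hpn F hF hFK]; exact zero_le_one
  · have hvK : ∀ F ∈ K, φ F v = 0 := fun F hF =>
      (hφ.mem_iff (hK hF).1).1 (Submodule.mem_sInf.1 hv F hF)
    have h1 := hgen v (fun F hF => (hvK F hF).ge) H hH h0
    have h2 := hgen (-v) (fun F hF => by simp [hvK F hF]) H hH h0
    rw [map_neg] at h2
    exact (hφ.mem_iff hH).2 (by linarith)
  · by_contra hn
    have h1 := hzero H hH.1 hle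
    rw [hpn H hH hn] at h1
    exact one_ne_zero h1

/-! ### Antipodes and crossing of faces -/

theorem separatingSet_subset (A : HyperplaneArrangement d) (B R : A.Region) :
    A.separatingSet B R ⊆ A.hyperplanes :=
  fun _ h => h.1

theorem separatingSet_self (A : HyperplaneArrangement d) (B : A.Region) :
    A.separatingSet B B = ∅ := by
  obtain ⟨b, hb, rfl⟩ := A.exists_eq_regionOf B
  obtain ⟨φ, hφ⟩ := A.exists_positiveAt hb
  ext H
  rw [hφ.mem_separatingSet]
  simpa using fun hH => (hφ H hH).2.le

/-- The antipodal region has the complementary separating set. -/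
theorem exists_separatingSet_eq_diff (A : HyperplaneArrangement d) (B R : A.Region) :
    ∃ R' : A.Region, A.separatingSet B R' = A.hyperplanes \ A.separatingSet B R := by
  obtain ⟨b, hb, rfl⟩ := A.exists_eq_regionOf B
  obtain ⟨x, hx, rfl⟩ := A.exists_eq_regionOf R
  obtain ⟨φ, hφ⟩ := A.exists_positiveAt hb
  have hx' : -x ∈ A.complement := fun H hH h => hx H hH (by simpa using h)
  refine ⟨A.regionOf (-x) hx', ?_⟩
  ext H
  rw [Set.mem_sdiff, hφ.mem_separatingSet, hφ.mem_separatingSet, map_neg, neg_lt_zero]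
  constructor
  · exact fun h => ⟨h.1, fun h' => h.2.not_gt h'.2⟩
  · exact fun h => ⟨h.1, hφ.pos_of_not_neg hx h.1 fun h' => h.2 ⟨h.1, h'⟩⟩

/-- Flip the signs of a family of functionals so as to make them positive at `z`. -/
theorem PositiveAt.flip {b z : EuclideanSpace ℝ (Fin d)} (hφ : A.PositiveAt φ b)
    (hz : z ∈ A.complement) :
    A.PositiveAt (fun H => if φ H z < 0 then -φ H else φ H) z := by
  intro H hH
  have hk := (hφ H hH).1
  by_cases h : φ H z < 0
  · simp only [h, if_true]
    refine ⟨?_, by simpa using h⟩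
    rw [← LinearMap.ker_neg] at hk
    exact hk
  · refine ⟨by simpa [h] using hk, by simpa [h] using hφ.pos_of_not_neg hz hH h⟩

/-- A region strictly above `Z` lies on the far side of some facet of `Z`. -/
theorem exists_facet_mem_diff (A : HyperplaneArrangement d) (B Z X : A.Region)
    (hle : A.separatingSet B Z ⊆ A.separatingSet B X)
    (hne : A.separatingSet B X ≠ A.separatingSet B Z) :
    ∃ H ∈ A.facetHyperplanes Z, H ∈ A.separatingSet B X ∧ H ∉ A.separatingSet B Z := by
  by_contra! hcon
  refine hne (subset_antisymm (fun H hH => ?_) hle)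
  obtain ⟨b, hb, rfl⟩ := A.exists_eq_regionOf B
  obtain ⟨z, hz, rfl⟩ := A.exists_eq_regionOf Z
  obtain ⟨x, hx, rfl⟩ := A.exists_eq_regionOf X
  obtain ⟨φ, hφ⟩ := A.exists_positiveAt hb
  rw [hφ.mem_separatingSet] at hH ⊢
  refine ⟨hH.1, ?_⟩
  by_contra hHz
  -- On the facets of `Z` the signs at `x` and `z` agree, so `x` satisfies every inequality of `Z`.
  have h0 := (hφ.flip hz).nonneg_of_nonneg_facets hz (y := x) (fun F hF => by
    have h1 : φ F x < 0 → φ F z < 0 := fun h =>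
      ((hφ.mem_separatingSet hb hz).1
        (hcon F hF ((hφ.mem_separatingSet hb hx).2 ⟨hF.1, h⟩))).2
    have h2 : φ F z < 0 → φ F x < 0 := fun h =>
      ((hφ.mem_separatingSet hb hx).1
        (hle ((hφ.mem_separatingSet hb hz).2 ⟨hF.1, h⟩))).2
    by_cases h : φ F z < 0
    · simpa [h] using (h2 h).le
    · simpa [h] using fun h' => h (h1 h')) H hH.1
  simp only [hHz, if_false] at h0
  exact h0.not_gt hH.2

/-- Passing through the face of `Z` spanned by facets not separating `Z` from `B`. -/
theorem exists_separatingSet_eq_union (A : HyperplaneArrangement d) (B Z : A.Region)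
    (hsimp : A.IsSimplicialRegion Z) {K : Set (Submodule ℝ (EuclideanSpace ℝ (Fin d)))}
    (hK : K ⊆ A.facetHyperplanes Z) (hKZ : ∀ H ∈ K, H ∉ A.separatingSet B Z) :
    (∃ W : A.Region, A.separatingSet B W =
      A.separatingSet B Z ∪ (A.parabolicSubarrangement K).hyperplanes) ∧
    ∀ Q : A.Region, K ⊆ A.separatingSet B Q →
      (A.parabolicSubarrangement K).hyperplanes ⊆ A.separatingSet B Q := by
  obtain ⟨b, hb, rfl⟩ := A.exists_eq_regionOf B
  obtain ⟨z, hz, rfl⟩ := A.exists_eq_regionOf Z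
  obtain ⟨φ, hφ⟩ := A.exists_positiveAt hb
  obtain ⟨p, hp, hp0, -, hgen⟩ := (hφ.flip hz).exists_face_point hz hsimp hK
  have hKz : ∀ H ∈ K, ¬ φ H z < 0 := fun H hH h =>
    hKZ H hH ((hφ.mem_separatingSet hb hz).2 ⟨(hK hH).1, h⟩)
  -- The point `b` satisfies the inequalities of `K` at `Z`, hence those of `A_K`; so no member of
  -- `A_K` separates `Z` from `B`.
  have hAK : ∀ H ∈ A.hyperplanes, sInf K ≤ H → ¬ φ H z < 0 := by
    intro H hH hle h
    have := hgen b (fun F hF => by simpa [hKz F hF] using (hφ F (hK hF).1).2.le) H hH hle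
    simp only [h, if_true, LinearMap.neg_apply] at this
    linarith [(hφ H hH).2]
  constructor
  · have hz' : -z ∈ A.complement := fun H hH h => hz H hH (by simpa using h)
    obtain ⟨y, hy, hy'⟩ := hφ.exists_perturbation p hz'
    refine ⟨A.regionOf y hy, ?_⟩
    ext H
    rw [Set.mem_union, hφ.mem_separatingSet, hφ.mem_separatingSet]
    change _ ↔ _ ∨ H ∈ A.hyperplanes ∧ sInf K ≤ H
    rw [← and_or_left]
    refine and_congr_right fun hH => ?_
    have hpH := hp H hH
    have hp0H := hp0 H hH
    by_cases hle : sInf K ≤ H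
    · have hz0 := hAK H hH hle
      have hpz : φ H p = 0 := by simpa [hz0] using hp0H.2 hle
      rw [(hy' H hH).2 hpz, map_neg, neg_lt_zero]
      exact iff_of_true (hφ.pos_of_not_neg hz hH hz0) (Or.inr hle)
    · have hne := fun h => hle (hp0H.1 h)
      have hpz : φ H p ≠ 0 := fun h => hne (by split_ifs <;> simp [h])
      rw [(hy' H hH).1 hpz]
      simp only [hle, or_false]
      by_cases h : φ H z < 0
      · simp only [h, if_true, LinearMap.neg_apply] at hpH
        exact iff_of_true (lt_of_le_of_ne (by linarith) hpz) h
      · simp only [h, if_false] at hpH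
        exact iff_of_false hpH.not_gt h
  · intro Q hQ H hH
    obtain ⟨q, hq, rfl⟩ := A.exists_eq_regionOf Q
    rw [hφ.mem_separatingSet]
    refine ⟨hH.1, ?_⟩
    have := hgen (-q) (fun F hF => by
      have := ((hφ.mem_separatingSet hb hq).1 (hQ hF)).2
      simpa [hKz F hF] using this.le) H hH.1 hH.2
    simp only [hAK H hH.1 hH.2, if_false, map_neg] at this
    exact lt_of_le_of_ne (by linarith) (hφ.ne_zero hq hH.1)

theorem hyperplanes_parabolicSubarrangement_singleton (A : HyperplaneArrangement d)
    {H : Submodule ℝ (EuclideanSpace ℝ (Fin d))} (hH : H ∈ A.hyperplanes) :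
    (A.parabolicSubarrangement {H}).hyperplanes = {H} := by
  ext H'
  constructor
  · rintro ⟨hH', hle⟩
    rw [sInf_singleton] at hle
    have h1 := A.codim_one H hH
    have h2 := A.codim_one H' hH'
    exact (Submodule.eq_of_le_of_finrank_le hle (by omega)).symm
  · rintro rfl
    exact ⟨hH, by rw [sInf_singleton]⟩

/-- The region adjacent to `Z` across a facet. -/
theorem exists_separatingSet_eq_insert (A : HyperplaneArrangement d) (B Z : A.Region)
    (hsimp : A.IsSimplicialRegion Z) {H : Submodule ℝ (EuclideanSpace ℝ (Fin d))}
    (hH : H ∈ A.facetHyperplanes Z) (hHZ : H ∉ A.separatingSet B Z) :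
    ∃ W : A.Region, A.separatingSet B W = insert H (A.separatingSet B Z) := by
  obtain ⟨⟨W, hW⟩, -⟩ := A.exists_separatingSet_eq_union B Z hsimp (K := {H})
    (Set.singleton_subset_iff.2 hH) (by rintro _ rfl; exact hHZ)
  refine ⟨W, ?_⟩
  rw [hW, A.hyperplanes_parabolicSubarrangement_singleton hH.1, Set.union_comm]
  rfl

/-! ### The lattice of regions -/

/-- Two regions above `Z` have a join. -/
theorem exists_join_of_le (hA : A.IsSimplicial) (B Z X Y : A.Region)
    (hZX : A.separatingSet B Z ⊆ A.separatingSet B X)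
    (hZY : A.separatingSet B Z ⊆ A.separatingSet B Y) :
    ∃ J : A.Region, A.separatingSet B X ⊆ A.separatingSet B J ∧
      A.separatingSet B Y ⊆ A.separatingSet B J ∧
      ∀ U : A.Region, A.separatingSet B X ⊆ A.separatingSet B U →
        A.separatingSet B Y ⊆ A.separatingSet B U →
        A.separatingSet B J ⊆ A.separatingSet B U := by
  -- Fewer hyperplanes remain outside the separating set as the common lower bound moves up.
  induction hn : (A.hyperplanes \ A.separatingSet B Z).ncard using Nat.strong_induction_on
    generalizing Z X Y with
  | _ n ih =>
  subst hn
  by_cases hX : A.separatingSet B X = A.separatingSet B Z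
  · exact ⟨Y, hX ▸ hZY, subset_rfl, fun U _ h => h⟩
  by_cases hY : A.separatingSet B Y = A.separatingSet B Z
  · exact ⟨X, subset_rfl, hY ▸ hZX, fun U h _ => h⟩
  obtain ⟨H₁, hH₁, hH₁X, hH₁Z⟩ := A.exists_facet_mem_diff B Z X hZX hX
  obtain ⟨H₂, hH₂, hH₂Y, hH₂Z⟩ := A.exists_facet_mem_diff B Z Y hZY hY
  obtain ⟨X', hX'⟩ := A.exists_separatingSet_eq_insert B Z (hA Z) hH₁ hH₁Z
  obtain ⟨Y', hY'⟩ := A.exists_separatingSet_eq_insert B Z (hA Z) hH₂ hH₂Z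
  -- `W` is the join of `X'` and `Y'`. The case `H₁ = H₂` is allowed.
  obtain ⟨⟨W, hW⟩, hWU⟩ := A.exists_separatingSet_eq_union B Z (hA Z) (K := {H₁, H₂})
    (by rintro _ (rfl | rfl) <;> assumption) (by rintro _ (rfl | rfl) <;> assumption)
  have hcard : ∀ H ∈ A.facetHyperplanes Z, H ∉ A.separatingSet B Z → ∀ Z' : A.Region,
      A.separatingSet B Z' = insert H (A.separatingSet B Z) →
      (A.hyperplanes \ A.separatingSet B Z').ncard <
        (A.hyperplanes \ A.separatingSet B Z).ncard := by
    intro H hH hHZ Z' hZ'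
    refine Set.ncard_lt_ncard ⟨?_, fun h => ?_⟩ (A.finite.subset Set.sdiff_subset)
    · rw [hZ']
      exact Set.sdiff_subset_sdiff_right (Set.subset_insert _ _)
    · exact (h ⟨hH.1, hHZ⟩).2 (hZ' ▸ Set.mem_insert _ _)
  have hX'X : A.separatingSet B X' ⊆ A.separatingSet B X :=
    hX' ▸ Set.insert_subset hH₁X hZX
  have hY'Y : A.separatingSet B Y' ⊆ A.separatingSet B Y :=
    hY' ▸ Set.insert_subset hH₂Y hZY
  have hX'W : A.separatingSet B X' ⊆ A.separatingSet B W := by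
    rw [hX', hW]
    exact Set.insert_subset (Or.inr ⟨hH₁.1, sInf_le (by simp)⟩) Set.subset_union_left
  have hY'W : A.separatingSet B Y' ⊆ A.separatingSet B W := by
    rw [hY', hW]
    exact Set.insert_subset (Or.inr ⟨hH₂.1, sInf_le (by simp)⟩) Set.subset_union_left
  -- Above `X'` form `J₁ = X ⊔ W`, which lies above `Y'`; above `Y'` form `J₁ ⊔ Y`. As `W` is below
  -- every common upper bound, this is `X ⊔ Y`.
  obtain ⟨J₁, hXJ₁, hWJ₁, hJ₁⟩ := ih _ (hcard H₁ hH₁ hH₁Z X' hX') X' X W hX'X hX'W rfl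
  obtain ⟨J, hJ₁J, hYJ, hJ⟩ :=
    ih _ (hcard H₂ hH₂ hH₂Z Y' hY') Y' J₁ Y (hY'W.trans hWJ₁) hY'Y rfl
  refine ⟨J, hXJ₁.trans hJ₁J, hYJ, fun U hXU hYU => hJ U (hJ₁ U hXU ?_) hYU⟩
  rw [hW]
  refine Set.union_subset (hZX.trans hXU) (hWU U ?_)
  rintro _ (rfl | rfl)
  exacts [hXU hH₁X, hYU hH₂Y]

theorem exists_join (hA : A.IsSimplicial) (B X Y : A.Region) :
    ∃ J : A.Region, A.separatingSet B X ⊆ A.separatingSet B J ∧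
      A.separatingSet B Y ⊆ A.separatingSet B J ∧
      ∀ U : A.Region, A.separatingSet B X ⊆ A.separatingSet B U →
        A.separatingSet B Y ⊆ A.separatingSet B U →
        A.separatingSet B J ⊆ A.separatingSet B U :=
  exists_join_of_le hA B B X Y (by simp [separatingSet_self]) (by simp [separatingSet_self])

/-- The antipodal map complements separating sets, so it reverses the order and carries joins to
meets. -/
theorem exists_meet (hA : A.IsSimplicial) (B X Y : A.Region) :
    ∃ M : A.Region, A.separatingSet B M ⊆ A.separatingSet B X ∧
      A.separatingSet B M ⊆ A.separatingSet B Y ∧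
      ∀ U : A.Region, A.separatingSet B U ⊆ A.separatingSet B X →
        A.separatingSet B U ⊆ A.separatingSet B Y →
        A.separatingSet B U ⊆ A.separatingSet B M := by
  obtain ⟨X', hX'⟩ := A.exists_separatingSet_eq_diff B X
  obtain ⟨Y', hY'⟩ := A.exists_separatingSet_eq_diff B Y
  obtain ⟨J, hXJ, hYJ, hJ⟩ := exists_join hA B X' Y'
  obtain ⟨M, hM⟩ := A.exists_separatingSet_eq_diff B J
  rw [hX'] at hXJ
  rw [hY'] at hYJ
  refine ⟨M, fun H hH => ?_, fun H hH => ?_, fun U hUX hUY => ?_⟩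
  · rw [hM] at hH
    by_contra h
    exact hH.2 (hXJ ⟨hH.1, h⟩)
  · rw [hM] at hH
    by_contra h
    exact hH.2 (hYJ ⟨hH.1, h⟩)
  · obtain ⟨U', hU'⟩ := A.exists_separatingSet_eq_diff B U
    have := hJ U' (by rw [hX', hU']; exact Set.sdiff_subset_sdiff_right hUX)
      (by rw [hY', hU']; exact Set.sdiff_subset_sdiff_right hUY)
    rw [hU'] at this
    intro H hH
    rw [hM]
    exact ⟨hH.1, fun h => (this h).2 hH⟩

/-- The lattice structure on the poset of regions of a simplicial arrangement. -/
@[reducible]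
def latticeOfRegions (hA : A.IsSimplicial) (B : A.Region) : Lattice A.Region :=
  { A.posetOfRegions B with
    sup := fun X Y => (exists_join hA B X Y).choose
    le_sup_left := fun X Y => (exists_join hA B X Y).choose_spec.1
    le_sup_right := fun X Y => (exists_join hA B X Y).choose_spec.2.1
    sup_le := fun X Y U h₁ h₂ => (exists_join hA B X Y).choose_spec.2.2 U h₁ h₂
    inf := fun X Y => (exists_meet hA B X Y).choose
    inf_le_left := fun X Y => (exists_meet hA B X Y).choose_spec.1
    inf_le_right := fun X Y => (exists_meet hA B X Y).choose_spec.2.1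
    le_inf := fun U X Y h₁ h₂ => (exists_meet hA B X Y).choose_spec.2.2 U h₁ h₂ }

/-! ### `Θ_K` is a lattice congruence -/

/-- The regions of a class of `Θ_K` are those with a given trace of the separating set on the
parabolic subarrangement. -/
theorem parabolicCongruence_iff (A : HyperplaneArrangement d)
    (K : Set (Submodule ℝ (EuclideanSpace ℝ (Fin d)))) (B R Q : A.Region) :
    A.parabolicCongruence K R Q ↔
      A.separatingSet B R ∩ (A.parabolicSubarrangement K).hyperplanes =
        A.separatingSet B Q ∩ (A.parabolicSubarrangement K).hyperplanes := by
  obtain ⟨b, hb, rfl⟩ := A.exists_eq_regionOf B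
  obtain ⟨x, hx, rfl⟩ := A.exists_eq_regionOf R
  obtain ⟨y, hy, rfl⟩ := A.exists_eq_regionOf Q
  obtain ⟨φ, hφ⟩ := A.exists_positiveAt hb
  have key : ∀ (v) (hv : v ∈ A.complement), A.parabolicRegion K (A.regionOf v hv) =
      (A.parabolicSubarrangement K).regionOf v (A.complement_subset_parabolic K hv) :=
    fun v hv => (A.existsUnique_parabolicRegion K _).unique
      (A.existsUnique_parabolicRegion K _).choose_spec.1
      (closure_mono (connectedComponentIn_mono v (A.complement_subset_parabolic K)))
  change A.parabolicRegion K _ = A.parabolicRegion K _ ↔ _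
  rw [key, key, (hφ.restrict K).regionOf_eq_iff, Set.ext_iff]
  refine forall_congr' fun H => ?_
  rw [Set.mem_inter_iff, Set.mem_inter_iff, hφ.mem_separatingSet, hφ.mem_separatingSet]
  have : H ∈ (A.parabolicSubarrangement K).hyperplanes → H ∈ A.hyperplanes := fun h => h.1
  tauto

/-- Each class of `Θ_K` has a least element. -/
theorem exists_separatingSet_eq_inter_parabolic (A : HyperplaneArrangement d) (B : A.Region)
    (hsimp : A.IsSimplicialRegion B) {K : Set (Submodule ℝ (EuclideanSpace ℝ (Fin d)))}
    (hK : K ⊆ A.facetHyperplanes B) (R : A.Region) :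
    ∃ M : A.Region, A.separatingSet B M =
      A.separatingSet B R ∩ (A.parabolicSubarrangement K).hyperplanes := by
  obtain ⟨b, hb, rfl⟩ := A.exists_eq_regionOf B
  obtain ⟨x, hx, rfl⟩ := A.exists_eq_regionOf R
  obtain ⟨φ, hφ⟩ := A.exists_positiveAt hb
  obtain ⟨p, hp, hp0, -, -⟩ := hφ.exists_face_point hb hsimp hK
  -- Near `p`, signs off `A_K` are those of `B`; on `A_K` they are copied from `x`.
  obtain ⟨y, hy, hy'⟩ := hφ.exists_perturbation p hx
  refine ⟨A.regionOf y hy, ?_⟩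
  ext H
  rw [Set.mem_inter_iff, hφ.mem_separatingSet, hφ.mem_separatingSet, and_assoc]
  refine and_congr_right fun hH => ?_
  change _ ↔ _ ∧ H ∈ A.hyperplanes ∧ sInf K ≤ H
  rw [← hp0 H hH]
  by_cases h : φ H p = 0
  · rw [(hy' H hH).2 h]
    tauto
  · rw [(hy' H hH).1 h]
    exact iff_of_false (hp H hH).not_gt fun h' => h h'.2.2

/-- Each class of `Θ_K` has a greatest element. -/
theorem exists_separatingSet_eq_union_parabolic (A : HyperplaneArrangement d) (B : A.Region)
    (hsimp : A.IsSimplicialRegion B) {K : Set (Submodule ℝ (EuclideanSpace ℝ (Fin d)))}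
    (hK : K ⊆ A.facetHyperplanes B) (R : A.Region) :
    ∃ M : A.Region, A.separatingSet B M = A.separatingSet B R ∪
      (A.hyperplanes \ (A.parabolicSubarrangement K).hyperplanes) := by
  obtain ⟨R', hR'⟩ := A.exists_separatingSet_eq_diff B R
  obtain ⟨M', hM'⟩ := A.exists_separatingSet_eq_inter_parabolic B hsimp hK R'
  obtain ⟨M, hM⟩ := A.exists_separatingSet_eq_diff B M'
  refine ⟨M, ?_⟩
  rw [hM, hM', hR']
  ext H
  have : H ∈ A.separatingSet B R → H ∈ A.hyperplanes := fun h => h.1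
  simp only [Set.mem_sdiff, Set.mem_inter_iff, Set.mem_union]
  tauto

/-- `Θ_K` as a lattice congruence. -/
theorem exists_latticeCon_eq_parabolicCongruence (hA : A.IsSimplicial) (B : A.Region)
    {K : Set (Submodule ℝ (EuclideanSpace ℝ (Fin d)))} (hK : K ⊆ A.facetHyperplanes B) :
    letI := latticeOfRegions hA B
    ∃ C : LatticeCon A.Region, C.toSetoid = A.parabolicCongruence K := by
  let _ := latticeOfRegions hA B
  set AK := (A.parabolicSubarrangement K).hyperplanes
  have hrel := A.parabolicCongruence_iff K B
  have hsup : ∀ {w x y z : A.Region}, A.parabolicCongruence K w x → A.parabolicCongruence K y z →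
      A.separatingSet B (w ⊔ y) ∩ AK ⊆ A.separatingSet B (x ⊔ z) ∩ AK := by
    intro w x y z h₁ h₂
    rw [hrel] at h₁ h₂
    -- `M` is the top of the class of `x ⊔ z`, so it bounds everything congruent to an element below
    -- `x ⊔ z`.
    obtain ⟨M, hM⟩ := A.exists_separatingSet_eq_union_parabolic B (hA B) hK (x ⊔ z)
    have hbound : ∀ u v : A.Region, A.separatingSet B u ∩ AK = A.separatingSet B v ∩ AK →
        v ≤ x ⊔ z → u ≤ M := by
      intro u v huv hv H hH
      rw [hM]
      by_cases h : H ∈ AK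
      · exact Or.inl (hv (huv.subset ⟨hH, h⟩).1)
      · exact Or.inr ⟨hH.1, h⟩
    have hM' : w ⊔ y ≤ M := sup_le (hbound w x h₁ le_sup_left) (hbound y z h₂ le_sup_right)
    rintro H ⟨hH, hHK⟩
    have := hM' hH
    rw [hM] at this
    exact ⟨this.resolve_right fun h => h.2 hHK, hHK⟩
  have hinf : ∀ {w x y z : A.Region}, A.parabolicCongruence K w x → A.parabolicCongruence K y z →
      A.separatingSet B (w ⊓ y) ∩ AK ⊆ A.separatingSet B (x ⊓ z) ∩ AK := by
    intro w x y z h₁ h₂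
    rw [hrel] at h₁ h₂
    obtain ⟨M, hM⟩ := A.exists_separatingSet_eq_inter_parabolic B (hA B) hK (w ⊓ y)
    have hbound : ∀ u v : A.Region, A.separatingSet B u ∩ AK = A.separatingSet B v ∩ AK →
        w ⊓ y ≤ u → M ≤ v := by
      intro u v huv hu H hH
      rw [hM] at hH
      exact (huv.subset ⟨hu hH.1, hH.2⟩).1
    have hM' : M ≤ x ⊓ z := le_inf (hbound w x h₁ inf_le_left) (hbound y z h₂ inf_le_right)
    rintro H hH
    exact ⟨hM' (hM ▸ hH), hH.2⟩
  exact ⟨{ toSetoid := A.parabolicCongruence K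
           inf := fun h₁ h₂ => (hrel _ _).2 <| subset_antisymm (hinf h₁ h₂)
             (hinf ((A.parabolicCongruence K).symm h₁) ((A.parabolicCongruence K).symm h₂))
           sup := fun h₁ h₂ => (hrel _ _).2 <| subset_antisymm (hsup h₁ h₂)
             (hsup ((A.parabolicCongruence K).symm h₁) ((A.parabolicCongruence K).symm h₂)) },
    rfl⟩

/-! ### Minimality of `Θ_K` -/

/-- A facet hyperplane outside `K` is not in the parabolic subarrangement of `K`. -/
theorem notMem_parabolic_of_notMem (A : HyperplaneArrangement d) (B : A.Region)
    (hsimp : A.IsSimplicialRegion B) {K : Set (Submodule ℝ (EuclideanSpace ℝ (Fin d)))}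
    (hK : K ⊆ A.facetHyperplanes B) {H : Submodule ℝ (EuclideanSpace ℝ (Fin d))}
    (hH : H ∈ A.facetHyperplanes B) (hHK : H ∉ K) :
    H ∉ (A.parabolicSubarrangement K).hyperplanes := by
  obtain ⟨b, hb, rfl⟩ := A.exists_eq_regionOf B
  obtain ⟨φ, hφ⟩ := A.exists_positiveAt hb
  obtain ⟨p, -, -, h, -⟩ := hφ.exists_face_point hb hsimp hK
  exact fun h' => hHK (h H hH h'.2)

/-- A region beyond all facets of `B` is the antipode of `B`. -/
theorem separatingSet_eq_of_facets_subset (A : HyperplaneArrangement d) (B Q : A.Region)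
    (h : A.facetHyperplanes B ⊆ A.separatingSet B Q) :
    A.separatingSet B Q = A.hyperplanes := by
  obtain ⟨b, hb, rfl⟩ := A.exists_eq_regionOf B
  obtain ⟨q, hq, rfl⟩ := A.exists_eq_regionOf Q
  obtain ⟨φ, hφ⟩ := A.exists_positiveAt hb
  refine subset_antisymm (A.separatingSet_subset _ _) fun H hH => ?_
  have := hφ.nonneg_of_nonneg_facets hb (y := -q)
    (fun F hF => by simpa using ((hφ.mem_separatingSet hb hq).1 (h hF)).2.le) H hH
  rw [map_neg] at this
  exact (hφ.mem_separatingSet hb hq).2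
    ⟨hH, lt_of_le_of_ne (by linarith) (hφ.ne_zero hq hH)⟩

/-- A lattice congruence identifying `B` with its neighbours across the facets outside `K` is
coarser than `Θ_K`. -/
theorem parabolicCongruence_le (hA : A.IsSimplicial) (B : A.Region)
    {K : Set (Submodule ℝ (EuclideanSpace ℝ (Fin d)))} (hK : K ⊆ A.facetHyperplanes B) :
    letI := latticeOfRegions hA B
    ∀ C : LatticeCon A.Region,
      (∀ H ∈ A.facetHyperplanes B \ K, ∃ R : A.Region, A.separatingSet B R = {H} ∧ C.r B R) →
      A.parabolicCongruence K ≤ C.toSetoid := by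
  let _ := latticeOfRegions hA B
  intro C hC
  set AK := (A.parabolicSubarrangement K).hyperplanes
  have hle : ∀ R Q : A.Region, R ≤ Q ↔ A.separatingSet B R ⊆ A.separatingSet B Q :=
    fun _ _ => Iff.rfl
  have hB : ∀ R : A.Region, B ≤ R := fun R => by
    rw [hle, separatingSet_self]; exact Set.empty_subset _
  obtain ⟨T, hT⟩ := A.exists_separatingSet_eq_diff B B
  rw [separatingSet_self, Set.sdiff_empty] at hT
  obtain ⟨D, hD⟩ := A.exists_separatingSet_eq_inter_parabolic B (hA B) hK T
  have hDK : A.separatingSet B D = AK := by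
    rw [hD, hT]
    exact Set.inter_eq_right.2 fun H hH => hH.1
  have hfin : (A.facetHyperplanes B \ K).Finite := A.finite.subset fun H hH => hH.1.1
  -- Join the regions `R(H)` to `D` one at a time; since `B ≡ R(H)` and `B` is the bottom, the class
  -- of `D` is never left.
  obtain ⟨X, hDX, hX, hCX⟩ : ∃ X : A.Region, D ≤ X ∧
      A.facetHyperplanes B \ K ⊆ A.separatingSet B X ∧ C.r D X := by
    refine Set.Finite.induction_on_subset
      (motive := fun s _ => ∃ X : A.Region, D ≤ X ∧ s ⊆ A.separatingSet B X ∧ C.r D X) _ hfin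
      ⟨D, le_rfl, Set.empty_subset _, C.refl D⟩ ?_
    · rintro H s hH - - ⟨X, hDX, hX, hCX⟩
      obtain ⟨R, hR, hBR⟩ := hC H hH
      refine ⟨X ⊔ R, hDX.trans le_sup_left, Set.insert_subset ?_ ?_, ?_⟩
      · exact (le_sup_right : R ≤ X ⊔ R) (hR ▸ Set.mem_singleton H)
      · exact hX.trans (le_sup_left : X ≤ X ⊔ R)
      · have := C.sup hCX hBR
        rwa [sup_eq_left.2 (hB D)] at this
  have hXA : A.separatingSet B X = A.hyperplanes := by
    refine A.separatingSet_eq_of_facets_subset B X fun H hH => ?_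
    by_cases h : H ∈ K
    · exact hDX (hDK ▸ ⟨hH.1, sInf_le h⟩)
    · exact hX ⟨hH, h⟩
  -- `X` is the top element, so meeting `D ≡ X` with `R` gives `R ⊓ D ≡ R`.
  have hmin : ∀ R : A.Region, C.r (R ⊓ D) R := fun R => by
    have := C.inf (C.refl R) hCX
    have hRX : R ≤ X := by rw [hle, hXA]; exact A.separatingSet_subset B R
    rwa [inf_eq_left.2 hRX] at this
  have hSmin : ∀ R : A.Region, A.separatingSet B (R ⊓ D) = A.separatingSet B R ∩ AK := by
    intro R
    obtain ⟨M, hM⟩ := A.exists_separatingSet_eq_inter_parabolic B (hA B) hK R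
    apply subset_antisymm
    · exact Set.subset_inter (inf_le_left : R ⊓ D ≤ R) (hDK ▸ (inf_le_right : R ⊓ D ≤ D))
    · rw [← hM]
      refine (le_inf ?_ ?_ : M ≤ R ⊓ D)
      · rw [hle, hM]; exact Set.inter_subset_left
      · rw [hle, hM, hDK]; exact Set.inter_subset_right
  intro R Q hRQ
  have hRQ' : R ⊓ D = Q ⊓ D := A.separatingSet_injective B <| by
    rw [hSmin, hSmin]
    exact (A.parabolicCongruence_iff K B R Q).1 hRQ
  exact C.trans (C.symm (hmin R)) (hRQ' ▸ hmin Q)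

end HyperplaneArrangement
end

open HyperplaneArrangement in
theorem theorem6p9 {d : ℕ} (A : HyperplaneArrangement d) (hA : A.IsSimplicial) (B : A.Region)
    (K : Set (Submodule ℝ (EuclideanSpace ℝ (Fin d)))) (hK : K ⊆ A.facetHyperplanes B) :
    ∃ L : Lattice A.Region,
      L.toSemilatticeSup.toPartialOrder = A.posetOfRegions B ∧
      IsLeast {Ψ : Setoid A.Region |
          (∃ C : LatticeCon A.Region, C.toSetoid = Ψ) ∧
          ∀ H ∈ A.facetHyperplanes B \ K, ∃ R : A.Region, A.separatingSet B R = {H} ∧ Ψ B R}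
        (A.parabolicCongruence K) := by
  refine ⟨latticeOfRegions hA B, rfl,
    ⟨exists_latticeCon_eq_parabolicCongruence hA B hK, fun H hH => ?_⟩, ?_⟩
  · obtain ⟨R, hR⟩ := A.exists_separatingSet_eq_insert B B (hA B) hH.1
      (by simp [separatingSet_self])
    rw [separatingSet_self, insert_empty_eq] at hR
    refine ⟨R, hR, (A.parabolicCongruence_iff K B B R).2 ?_⟩
    rw [separatingSet_self, Set.empty_inter, hR]
    exact (Set.singleton_inter_eq_empty.2
      (A.notMem_parabolic_of_notMem B (hA B) hK hH.1 hH.2)).symm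
  · rintro _ ⟨⟨C, rfl⟩, hC⟩
    exact parabolicCongruence_le hA B hK C hC
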